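/- No reordered computable real number is Martin-Löf random. Here the notions are as follows. A sequence $(a_n)_n$ of real numbers with limit $a$ \emph{converges computably} if there is a computable function $s\colon\mathbb N\to\mathbb N$ with $|a-a_k|\le 2^{-n}$ for all $n$ and all $k\ge s(n)$; a series converges computably if its sequence of partial sums does. For $f\colon\mathbb N\to\mathbb N$ tending to infinity let $u_f(n)$ be the number of $k\in\mathbb N$ with $f(k)=n$. A real number $x$ is \emph{reordered computable} if there is a computable function $f\colon\mathbb N\to\mathbb N$ such that $\sum_{k=0}^\infty 2^{-f(k)}=x$ and the series $\sum_{k=0}^\infty u_f(k)\cdot 2^{-k}$ converges computably. A \emph{Martin-Löf test} is a sequence $(U_n)_n$ of subsets of $\mathbb R$ with Lebesgue measure $\lambda(U_n)\le 2^{-n}$ for all $n$ for which there are computable double sequences $(p_{n,i})$, $(q_{n,i})$ of rational numbers with $U_n=\bigcup_{i\in\mathbb N}(p_{n,i},q_{n,i})$ for all $n$ (where $(p,q)=\emptyset$ if $p\ge q$). A real number $x$ is \emph{Martin-Löf random} if $x\notin\bigcap_n U_n$ for every Martin-Löf test $(U_n)_n$. -/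

import Mathlib

open Filter Topology MeasureTheory
open scoped ENNReal

noncomputable section

/-- A sequence of real numbers converges computably if it converges and has a computable modulus
of convergence: a computable `s : ℕ → ℕ` with `|x - a k| ≤ 2⁻ⁿ` for all `n` and all `k ≥ s n`,
where `x` is the limit. -/
def ConvergesComputably (a : ℕ → ℝ) : Prop :=
  ∃ x : ℝ, Tendsto a atTop (𝓝 x) ∧
    ∃ s : ℕ → ℕ, Computable s ∧ ∀ n k : ℕ, s n ≤ k → |x - a k| ≤ (1 / 2 : ℝ) ^ n

/-- A series converges computably if its sequence of partial sums does. -/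
def SeriesConvergesComputably (a : ℕ → ℝ) : Prop :=
  ConvergesComputably fun n => ∑ k ∈ Finset.range n, a k

/-- `f` is a name for the real number `x` if the dyadic series of the `2 ^ (-f k)` has sum `x`. -/
def IsName (f : ℕ → ℕ) (x : ℝ) : Prop :=
  HasSum (fun k => (1 / 2 : ℝ) ^ f k) x

/-- `u_f(n)`, the number of `k` with `f k = n`. This set is finite for every `n` whenever `f` tends
to infinity, in particular whenever `f` is a name of some real number. -/
def multiplicity_u (f : ℕ → ℕ) (n : ℕ) : ℕ :=
  Set.ncard {k : ℕ | f k = n}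

/-- A real number is reordered computable if it has a computable name `f` such that the series of
the `u_f(k) * 2⁻ᵏ` converges computably. -/
def ReorderedComputable (x : ℝ) : Prop :=
  ∃ f : ℕ → ℕ, Computable f ∧ IsName f x ∧
    SeriesConvergesComputably fun k => (multiplicity_u f k : ℝ) * (1 / 2 : ℝ) ^ k

/-- The standard notation of the rational numbers: `(i, j, k)` denotes `(i - j) / (k + 1)`. -/
def ratOfCode (c : ℕ × ℕ × ℕ) : ℚ :=
  ((c.1 : ℚ) - (c.2.1 : ℚ)) / ((c.2.2 : ℚ) + 1)

/-- A sequence of subsets of the real line is uniformly computably enumerable open if there is a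
computable double sequence of pairs of rational endpoints such that the `n`-th set is the union of
the open intervals in the `n`-th row. An interval whose left endpoint is not below its right
endpoint is empty, so empty sets and finite unions are included. -/
def UniformlyCEOpen (U : ℕ → Set ℝ) : Prop :=
  ∃ a b : ℕ → ℕ → ℕ × ℕ × ℕ, Computable₂ a ∧ Computable₂ b ∧
    ∀ n, U n = ⋃ i, Set.Ioo (ratOfCode (a n i) : ℝ) (ratOfCode (b n i) : ℝ)

/-- A Martin-Löf test on the real line: a uniformly computably enumerable sequence of open sets
whose `n`-th member has Lebesgue measure at most `2⁻ⁿ`. -/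
def IsMartinLofTest (U : ℕ → Set ℝ) : Prop :=
  UniformlyCEOpen U ∧ ∀ n, volume (U n) ≤ (2⁻¹ : ℝ≥0∞) ^ n

/-- A real number is Martin-Löf random if no Martin-Löf test captures it. -/
def MartinLofRandom (x : ℝ) : Prop :=
  ∀ U : ℕ → Set ℝ, IsMartinLofTest U → x ∉ ⋂ n, U n

end

/-! Fix `M`. From some index on every `f k` is at least `M`; let `K` be the least such index. It
cannot be computed, so a walk restarts at the current partial sum whenever `f k < M` and takes steps
of twice the term otherwise. The last restart leaves it at the partial sum `S K < x`, and from there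
it tends to `2 * x - S K > x`, so one of its steps jumps over `x` (`IsName.mem_runSet`). The
intervals around all steps, in every run, have total length at most three times the sum of the terms
with `f k ≥ M`. The modulus of the rearranged series makes that sum small (`sum_le_of_modulus`),
which gives the test. -/

/-- One step of the recursion `runState`. -/
def runStep (M e : ℕ) (p : ℕ × ℕ × ℕ) : ℕ × ℕ × ℕ :=
  (p.1 * 2 ^ e, p.2.1 * 2 ^ e + p.1,
    if M ≤ e then p.2.2 * 2 ^ e + 2 * p.1 else p.2.1 * 2 ^ e + p.1)

/-- The triple `(d, a, b)` where `a / d` is the `k`-th partial sum of the series of the `2 ^ (-f j)`,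
and `b / d` is that partial sum plus the contribution of the maximal run of indices `j < k` with
`M ≤ f j` that ends at `k`; so the terms of that run are counted twice in `b / d`. -/
def runState (f : ℕ → ℕ) (M : ℕ) (k : ℕ) : ℕ × ℕ × ℕ :=
  Nat.rec (1, 0, 0) (fun j p => runStep M (f j) p) k

/-- The partial sum with the terms of the current run counted twice. -/
noncomputable def runValue (f : ℕ → ℕ) (M k : ℕ) : ℝ :=
  ((runState f M k).2.2 : ℝ) / (runState f M k).1

theorem runState_succ (f : ℕ → ℕ) (M k : ℕ) :
    runState f M (k + 1) = runStep M (f k) (runState f M k) := rfl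

theorem runState_fst_pos (f : ℕ → ℕ) (M k : ℕ) : 0 < (runState f M k).1 := by
  induction k with
  | zero => exact Nat.one_pos
  | succ k ih => rw [runState_succ]; exact Nat.mul_pos ih (by positivity)

theorem runState_partialSum (f : ℕ → ℕ) (M k : ℕ) :
    ((runState f M k).2.1 : ℝ) / (runState f M k).1 =
      ∑ j ∈ Finset.range k, (1 / 2 : ℝ) ^ f j := by
  induction k with
  | zero => simp [runState]
  | succ k ih =>
    have hp : ((runState f M k).1 : ℝ) ≠ 0 := by exact_mod_cast (runState_fst_pos f M k).ne'
    rw [Finset.sum_range_succ, ← ih, runState_succ]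
    simp only [runStep]
    push_cast
    rw [one_div_pow]
    field_simp

theorem runValue_zero (f : ℕ → ℕ) (M : ℕ) : runValue f M 0 = 0 := by
  simp [runValue, runState]

theorem runValue_succ_of_le (f : ℕ → ℕ) {M k : ℕ} (h : M ≤ f k) :
    runValue f M (k + 1) = runValue f M k + 2 * (1 / 2 : ℝ) ^ f k := by
  have hp : ((runState f M k).1 : ℝ) ≠ 0 := by exact_mod_cast (runState_fst_pos f M k).ne'
  simp only [runValue, runState_succ, runStep, if_pos h]
  push_cast
  rw [one_div_pow]
  field_simp

theorem runValue_succ_of_lt (f : ℕ → ℕ) {M k : ℕ} (h : f k < M) :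
    runValue f M (k + 1) = ∑ j ∈ Finset.range (k + 1), (1 / 2 : ℝ) ^ f j := by
  rw [← runState_partialSum f M (k + 1)]
  simp only [runValue, runState_succ, runStep, if_neg (not_le.2 h)]

/-- Code of the left endpoint of the `k`-th interval. -/
def runLeft (f : ℕ → ℕ) (M k : ℕ) : ℕ × ℕ × ℕ :=
  if M ≤ f k then
    ((runState f M k).2.2 * 2 ^ f k, (runState f M k).1, (runState f M k).1 * 2 ^ f k - 1)
  else (0, 0, 0)

/-- Code of the right endpoint of the `k`-th interval. -/
def runRight (f : ℕ → ℕ) (M k : ℕ) : ℕ × ℕ × ℕ :=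
  if M ≤ f k then
    ((runState f M k).2.2 * 2 ^ f k + 2 * (runState f M k).1, 0,
      (runState f M k).1 * 2 ^ f k - 1)
  else (0, 0, 0)

/-- `ratOfCode` divides by the successor of the last entry, so codes store `d - 1`; positivity of
`d` makes the truncated subtraction exact. -/
theorem ratOfCode_pred (a b : ℕ) {d : ℕ} (hd : 0 < d) :
    (ratOfCode (a, b, d - 1) : ℝ) = ((a : ℝ) - b) / d := by
  obtain ⟨d, rfl⟩ := Nat.exists_eq_succ_of_ne_zero hd.ne'
  simp [ratOfCode]

/-- The margin to the left of the run value keeps that value inside the open interval, in case it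
equals `x`. -/
theorem ratOfCode_runLeft (f : ℕ → ℕ) {M k : ℕ} (h : M ≤ f k) :
    (ratOfCode (runLeft f M k) : ℝ) = runValue f M k - (1 / 2 : ℝ) ^ f k := by
  have hp : ((runState f M k).1 : ℝ) ≠ 0 := by exact_mod_cast (runState_fst_pos f M k).ne'
  rw [runLeft, if_pos h, ratOfCode_pred _ _ (Nat.mul_pos (runState_fst_pos f M k) (by positivity)),
    runValue, one_div_pow]
  push_cast
  field_simp

theorem ratOfCode_runRight (f : ℕ → ℕ) {M k : ℕ} (h : M ≤ f k) :
    (ratOfCode (runRight f M k) : ℝ) = runValue f M k + 2 * (1 / 2 : ℝ) ^ f k := by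
  have hp : ((runState f M k).1 : ℝ) ≠ 0 := by exact_mod_cast (runState_fst_pos f M k).ne'
  rw [runRight, if_pos h, ratOfCode_pred _ _ (Nat.mul_pos (runState_fst_pos f M k) (by positivity)),
    runValue, one_div_pow]
  push_cast
  field_simp
  ring

/-! ### Computability of the interval endpoints -/

theorem primrec₂_mul_two_pow : Primrec₂ fun a b : ℕ => a * 2 ^ b := by
  have hpow : Primrec₂ ((· ^ ·) : ℕ → ℕ → ℕ) := Primrec₂.unpaired'.1 Nat.Primrec.pow
  exact Primrec.nat_mul.comp Primrec.fst (hpow.comp (Primrec.const 2) Primrec.snd)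

theorem primrec_runStep :
    Primrec fun q : ℕ × ℕ × (ℕ × ℕ × ℕ) => runStep q.1 q.2.1 q.2.2 := by
  have hM : Primrec fun q : ℕ × ℕ × (ℕ × ℕ × ℕ) => q.1 := Primrec.fst
  have he : Primrec fun q : ℕ × ℕ × (ℕ × ℕ × ℕ) => q.2.1 := Primrec.fst.comp Primrec.snd
  have hp : Primrec fun q : ℕ × ℕ × (ℕ × ℕ × ℕ) => q.2.2 := Primrec.snd.comp Primrec.snd
  have h1 := Primrec.fst.comp hp
  have h2 := Primrec.fst.comp (Primrec.snd.comp hp)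
  have h3 := Primrec.snd.comp (Primrec.snd.comp hp)
  have hs := Primrec.nat_add.comp (primrec₂_mul_two_pow.comp h2 he) h1
  have hd := Primrec.nat_add.comp (primrec₂_mul_two_pow.comp h3 he)
    (Primrec.nat_mul.comp (Primrec.const 2) h1)
  refine ((primrec₂_mul_two_pow.comp h1 he).pair
    (hs.pair (Primrec.ite (Primrec.nat_le.comp hM he) hd hs))).of_eq fun q => ?_
  simp only [runStep]

/-- Uniformity in the threshold matters: it varies with the level of the test. -/
theorem computable_runState {f : ℕ → ℕ} (hf : Computable f) :
    Computable fun q : ℕ × ℕ => runState f q.1 q.2 := by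
  have hdata : Computable fun p : (ℕ × ℕ) × (ℕ × (ℕ × ℕ × ℕ)) => (p.1.1, f p.2.1, p.2.2) :=
    (Computable.fst.comp Computable.fst).pair
      ((hf.comp (Computable.fst.comp Computable.snd)).pair (Computable.snd.comp Computable.snd))
  have hstep : Computable₂ fun (q : ℕ × ℕ) (r : ℕ × (ℕ × ℕ × ℕ)) => runStep q.1 (f r.1) r.2 := by
    refine (primrec_runStep.to_comp.comp hdata).of_eq fun p => ?_
    simp only
  refine (Computable.nat_rec Computable.snd (Computable.const (1, 0, 0)) hstep).of_eq fun q => ?_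
  simp only [runState]

/-- The data from which the endpoint codes are computed primitive recursively. -/
theorem computable_runData {f : ℕ → ℕ} (hf : Computable f) :
    Computable fun q : ℕ × ℕ => (q.1, f q.2, runState f q.1 q.2) :=
  Computable.fst.pair ((hf.comp Computable.snd).pair (computable_runState hf))

theorem computable_runLeft {f : ℕ → ℕ} (hf : Computable f) :
    Computable fun q : ℕ × ℕ => runLeft f q.1 q.2 := by
  have hM : Primrec fun q : ℕ × ℕ × (ℕ × ℕ × ℕ) => q.1 := Primrec.fst
  have he : Primrec fun q : ℕ × ℕ × (ℕ × ℕ × ℕ) => q.2.1 := Primrec.fst.comp Primrec.snd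
  have hp : Primrec fun q : ℕ × ℕ × (ℕ × ℕ × ℕ) => q.2.2 := Primrec.snd.comp Primrec.snd
  have h1 := Primrec.fst.comp hp
  have h3 := Primrec.snd.comp (Primrec.snd.comp hp)
  have := Primrec.ite (Primrec.nat_le.comp hM he)
    ((primrec₂_mul_two_pow.comp h3 he).pair
      (h1.pair (Primrec.nat_sub.comp (primrec₂_mul_two_pow.comp h1 he) (Primrec.const 1))))
    (Primrec.const (0, 0, 0))
  refine (this.to_comp.comp (computable_runData hf)).of_eq fun q => ?_
  simp only [runLeft]

theorem computable_runRight {f : ℕ → ℕ} (hf : Computable f) :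
    Computable fun q : ℕ × ℕ => runRight f q.1 q.2 := by
  have hM : Primrec fun q : ℕ × ℕ × (ℕ × ℕ × ℕ) => q.1 := Primrec.fst
  have he : Primrec fun q : ℕ × ℕ × (ℕ × ℕ × ℕ) => q.2.1 := Primrec.fst.comp Primrec.snd
  have hp : Primrec fun q : ℕ × ℕ × (ℕ × ℕ × ℕ) => q.2.2 := Primrec.snd.comp Primrec.snd
  have h1 := Primrec.fst.comp hp
  have h3 := Primrec.snd.comp (Primrec.snd.comp hp)
  have := Primrec.ite (Primrec.nat_le.comp hM he)
    ((Primrec.nat_add.comp (primrec₂_mul_two_pow.comp h3 he)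
        (Primrec.nat_mul.comp (Primrec.const 2) h1)).pair
      ((Primrec.const 0).pair
        (Primrec.nat_sub.comp (primrec₂_mul_two_pow.comp h1 he) (Primrec.const 1))))
    (Primrec.const (0, 0, 0))
  refine (this.to_comp.comp (computable_runData hf)).of_eq fun q => ?_
  simp only [runRight]

/-- The open set of the intervals attached to the indices `k` with `M ≤ f k`. -/
def runSet (f : ℕ → ℕ) (M : ℕ) : Set ℝ :=
  ⋃ k, Set.Ioo (ratOfCode (runLeft f M k) : ℝ) (ratOfCode (runRight f M k) : ℝ)

theorem uniformlyCEOpen_runSet {f s : ℕ → ℕ} (hf : Computable f) (hs : Computable s) :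
    UniformlyCEOpen fun n => runSet f (s n) :=
  ⟨fun n k => runLeft f (s n) k, fun n k => runRight f (s n) k,
    (computable_runLeft hf).comp ((hs.comp Computable.fst).pair Computable.snd),
    (computable_runRight hf).comp ((hs.comp Computable.fst).pair Computable.snd),
    fun _ => rfl⟩

/-! ### Measure of the cover -/

theorem IsName.eventually_le {f : ℕ → ℕ} {x : ℝ} (h : IsName f x) (M : ℕ) :
    ∀ᶠ k in cofinite, M ≤ f k := by
  have := (h.summable.tendsto_cofinite_zero).eventually_lt_const
    (show (0 : ℝ) < (1 / 2) ^ M by positivity)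
  filter_upwards [this] with k hk
  exact ((pow_lt_pow_iff_right_of_lt_one₀ (by norm_num) (by norm_num)).1 hk).le

theorem IsName.finite_fiber {f : ℕ → ℕ} {x : ℝ} (h : IsName f x) (j : ℕ) :
    {k | f k = j}.Finite := by
  refine (eventually_cofinite.1 (h.eventually_le (j + 1))).subset fun k hk => ?_
  simp only [Set.mem_ofPred_eq] at hk ⊢
  omega

/-- The modulus of convergence of the rearranged series bounds the sum of the terms
`2 ^ (-f k)` with `f k` at least the modulus. -/
theorem sum_le_of_modulus {f : ℕ → ℕ} (hfin : ∀ j, {k | f k = j}.Finite) {y : ℝ} {M : ℕ} {ε : ℝ}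
    (hy : Tendsto (fun n => ∑ k ∈ Finset.range n, (multiplicity_u f k : ℝ) * (1 / 2 : ℝ) ^ k)
      atTop (𝓝 y))
    (hM : |y - ∑ k ∈ Finset.range M, (multiplicity_u f k : ℝ) * (1 / 2 : ℝ) ^ k| ≤ ε)
    (F : Finset ℕ) (hF : ∀ k ∈ F, M ≤ f k) :
    ∑ k ∈ F, (1 / 2 : ℝ) ^ f k ≤ ε := by
  set t : ℕ → ℝ := fun k => (multiplicity_u f k : ℝ) * (1 / 2 : ℝ) ^ k with ht
  have ht0 : ∀ k, 0 ≤ t k := fun k => by positivity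
  have hmono : Monotone fun n => ∑ k ∈ Finset.range n, t k := fun a b hab =>
    Finset.sum_le_sum_of_subset_of_nonneg (Finset.range_mono hab) fun k _ _ => ht0 k
  obtain ⟨N, hN⟩ : ∃ N, M ≤ N ∧ ∀ k ∈ F, f k < N :=
    ⟨max M (F.sup f + 1), le_max_left _ _, fun k hk =>
      lt_of_lt_of_le (Nat.lt_succ_of_le (Finset.le_sup hk)) (le_max_right _ _)⟩
  have hmaps : ∀ k ∈ F, f k ∈ Finset.Ico M N := fun k hk =>
    Finset.mem_Ico.2 ⟨hF k hk, hN.2 k hk⟩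
  -- Grouping by the value `j` of `f` compares the sum with a block of the rearranged series.
  calc ∑ k ∈ F, (1 / 2 : ℝ) ^ f k
      = ∑ j ∈ Finset.Ico M N, ∑ k ∈ F with f k = j, (1 / 2 : ℝ) ^ f k :=
        (Finset.sum_fiberwise_of_maps_to hmaps _).symm
    _ ≤ ∑ j ∈ Finset.Ico M N, t j := by
        refine Finset.sum_le_sum fun j _ => ?_
        rw [Finset.sum_congr rfl fun k hk => by rw [(Finset.mem_filter.1 hk).2],
          Finset.sum_const, nsmul_eq_mul]
        refine mul_le_mul_of_nonneg_right ?_ (by positivity)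
        rw [multiplicity_u, ← Set.ncard_coe_finset]
        have hsub : (↑(F.filter fun k => f k = j) : Set ℕ) ⊆ {k | f k = j} := fun k hk =>
          (Finset.mem_filter.1 (Finset.mem_coe.1 hk)).2
        -- Finiteness is essential: `Set.ncard` of an infinite fiber would be `0`.
        exact Nat.cast_le.2 (Set.ncard_le_ncard hsub (hfin j))
    _ = ∑ j ∈ Finset.range N, t j - ∑ j ∈ Finset.range M, t j :=
        Finset.sum_Ico_eq_sub t hN.1
    _ ≤ y - ∑ j ∈ Finset.range M, t j := sub_le_sub_right (hmono.ge_of_tendsto hy N) _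
    _ ≤ ε := (le_abs_self _).trans hM

theorem volume_runSet_le {f : ℕ → ℕ} {M : ℕ} {ε : ℝ}
    (h : ∀ F : Finset ℕ, (∀ k ∈ F, M ≤ f k) → ∑ k ∈ F, (1 / 2 : ℝ) ^ f k ≤ ε) :
    volume (runSet f M) ≤ ENNReal.ofReal (3 * ε) := by
  refine (measure_iUnion_le _).trans (ENNReal.tsum_eq_iSup_sum.trans_le (iSup_le fun F => ?_))
  have hterm : ∀ k, volume (Set.Ioo (ratOfCode (runLeft f M k) : ℝ) (ratOfCode (runRight f M k))) =
      if M ≤ f k then ENNReal.ofReal (3 * (1 / 2 : ℝ) ^ f k) else 0 := fun k => by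
    split_ifs with hk
    · rw [Real.volume_Ioo, ratOfCode_runLeft f hk, ratOfCode_runRight f hk]
      congr 1
      ring
    · simp [runLeft, runRight, hk]
  rw [Finset.sum_congr rfl fun k _ => hterm k, ← Finset.sum_filter,
    ← ENNReal.ofReal_sum_of_nonneg fun k _ => by positivity, ← Finset.mul_sum]
  exact ENNReal.ofReal_le_ofReal
    (mul_le_mul_of_nonneg_left (h _ fun k hk => (Finset.mem_filter.1 hk).2) (by norm_num))

/-! ### Capturing `x` -/

theorem IsName.mem_runSet {f : ℕ → ℕ} {x : ℝ} (h : IsName f x) (M : ℕ) : x ∈ runSet f M := by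
  set S : ℕ → ℝ := fun k => ∑ j ∈ Finset.range k, (1 / 2 : ℝ) ^ f j with hS
  have hlim : Tendsto S atTop (𝓝 x) := h.tendsto_sum_nat
  have hSlt : ∀ k, S k < x := fun k =>
    lt_of_lt_of_le (show S k < S (k + 1) by
      simp only [hS, Finset.sum_range_succ]; exact lt_add_of_pos_right _ (by positivity))
      (sum_le_hasSum _ (fun _ _ => by positivity) h)
  have hev : ∃ K, ∀ k ≥ K, M ≤ f k := by
    have := h.eventually_le M
    rwa [Nat.cofinite_eq_atTop, eventually_atTop] at this
  classical
  obtain ⟨K, hK, hmin⟩ : ∃ K, (∀ k ≥ K, M ≤ f k) ∧ ∀ K' < K, ¬ ∀ k ≥ K', M ≤ f k :=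
    ⟨Nat.find hev, Nat.find_spec hev, fun _ => Nat.find_min hev⟩
  -- By minimality of `K`, either `K = 0` or the preceding exponent is below `M` and has just reset
  -- the walk.
  have hstart : runValue f M K = S K := by
    cases K with
    | zero => simp [runValue_zero, hS]
    | succ K =>
      refine runValue_succ_of_lt f (not_le.1 fun hle => hmin K (Nat.lt_succ_self K) fun k hk => ?_)
      rcases hk.eq_or_lt with rfl | hk
      · exact hle
      · exact hK k hk
  have hrun : ∀ i, runValue f M (K + i) = 2 * S (K + i) - S K := fun i => by
    induction i with
    | zero => rw [add_zero, hstart]; ring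
    | succ i ih =>
      rw [← add_assoc, runValue_succ_of_le f (hK _ (Nat.le_add_right K i)), ih]
      simp only [hS, Finset.sum_range_succ]
      ring
  have hex : ∃ i, x < runValue f M (K + i) := by
    have : Tendsto (fun i => 2 * S (K + i) - S K) atTop (𝓝 (2 * x - S K)) := by
      have := (hlim.comp (tendsto_add_atTop_nat K)).const_mul 2 |>.sub_const (S K)
      simpa only [Function.comp_def, add_comm K] using this
    obtain ⟨i, hi⟩ := (this.eventually_const_lt (show x < 2 * x - S K by
      linarith [hSlt K])).exists
    exact ⟨i, (hrun i).symm ▸ hi⟩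
  -- At the first passage beyond `x`, the previous value is still at most `x`.
  obtain ⟨i, hi, himin⟩ : ∃ i, x < runValue f M (K + i) ∧ ∀ j < i, ¬ x < runValue f M (K + j) :=
    ⟨Nat.find hex, Nat.find_spec hex, fun _ => Nat.find_min hex⟩
  cases i with
  | zero =>
    rw [add_zero, hstart] at hi
    exact absurd hi (hSlt K).not_gt
  | succ i =>
    have hle : M ≤ f (K + i) := hK _ (Nat.le_add_right K i)
    have hge := not_lt.1 (himin i (Nat.lt_succ_self i))
    rw [← add_assoc, runValue_succ_of_le f hle] at hi
    have hpos : (0 : ℝ) < (1 / 2 : ℝ) ^ f (K + i) := by positivity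
    refine Set.mem_iUnion.2 ⟨K + i, ?_, ?_⟩
    · rw [ratOfCode_runLeft f hle]; linarith
    · rw [ratOfCode_runRight f hle]; exact hi

theorem mainTheorem9 (x : ℝ) (hx : ReorderedComputable x) : ¬ MartinLofRandom x := by
  obtain ⟨f, hf, hname, y, hy, s, hs, hmod⟩ := hx
  intro hrandom
  -- The shift by 2 absorbs the factor 3 in the measure bound, since 3/4 ≤ 1.
  refine hrandom (fun n => runSet f (s (n + 2)))
    ⟨uniformlyCEOpen_runSet (s := fun n => s (n + 2)) hf
      (hs.comp (Primrec.nat_add.comp Primrec.id (Primrec.const 2)).to_comp), fun n => ?_⟩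
    (Set.mem_iInter.2 fun n => hname.mem_runSet (s (n + 2)))
  refine (volume_runSet_le
    (sum_le_of_modulus hname.finite_fiber hy (hmod (n + 2) _ le_rfl))).trans ?_
  rw [show (2⁻¹ : ℝ≥0∞) ^ n = ENNReal.ofReal ((1 / 2 : ℝ) ^ n) by
    rw [ENNReal.ofReal_pow (by norm_num), one_div, ENNReal.ofReal_inv_of_pos (by norm_num)]; simp]
  refine ENNReal.ofReal_le_ofReal ?_
  rw [pow_add]
  nlinarith [show (0 : ℝ) < (1 / 2 : ℝ) ^ n by positivity]
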